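/- Let $K$ and $H$ be groups and let $\alpha\colon H\to \operatorname{Out}(K)=\operatorname{Aut}(K)/\operatorname{Inn}(K)$ be a group homomorphism. Regard the center $Z(K)$ as an $H$-module by letting $h\in H$ act through any automorphism representing $\alpha(h)$, and let $H^n(H,Z(K))$ denote group cohomology (of the complex of inhomogeneous cochains). Let $\mathcal E(K,H,\alpha)$ be the set of equivalence classes of group extensions $1\to K\xrightarrow{i} E\xrightarrow{p} H\to 1$ that induce $\alpha$, i.e. such that for every $e\in E$ the automorphism of $K$ given by conjugation by $e$ represents $\alpha(p(e))$. Two extensions are equivalent if there is an isomorphism of the middle groups that is compatible with the inclusions of $K$ and with the projections to $H$. A lift of $\alpha$ consists of maps $t\colon H\to\operatorname{Aut}(K)$ and $\eta\colon H\times H\to K$ such that $t(g)$ represents $\alpha(g)$ and $t(g)\circ t(h)=c_{\eta(g,h)}\circ t(gh)$ for all $g,h\in H$, where $c_x(y)=xyx^{-1}$. Lifts exist, and for a lift the elements $$\kappa(g,h,k)=t(g)\big(\eta(h,k)\big)\,\eta(g,hk)\,\big(\eta(g,h)\,\eta(gh,k)\big)^{-1}$$ lie in $Z(K)$ and form a $3$-cocycle.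 (i) The class $[\kappa]\in H^3(H,Z(K))$ does not depend on the chosen lift, and $\mathcal E(K,H,\alpha)$ is nonempty if and only if $[\kappa]=0$. (ii) If $\mathcal E(K,H,\alpha)$ is nonempty, then $H^2(H,Z(K))$ acts freely and transitively on it. Explicitly, the class of a $2$-cocycle $c$ sends the class of an extension $K\xrightarrow{i}E\xrightarrow{p}H$ to the class of the extension whose middle group is the set $E$ with the multiplication $$e*e'=i\big(c(p(e),p(e'))\big)\,e\,e',$$ with the same projection $p$ and with the inclusion $x\mapsto i\big(x\,c(1,1)^{-1}\big)$ (that is, factor sets are multiplied by $c$). -/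

import Mathlib

universe u

namespace ClassicalExtension

open CategoryTheory
open scoped IsMulCommutative

/-! ## Outer automorphisms and their action on the center -/

/-- The inner automorphisms of a group. -/
def Inn (K : Type u) [Group K] : Subgroup (MulAut K) := (MulAut.conj : K →* MulAut K).range

instance (K : Type u) [Group K] : (Inn K).Normal where
  conj_mem := by
    rintro _ ⟨x, rfl⟩ s
    refine ⟨s x, ?_⟩
    ext y
    simp [MulAut.mul_apply, MulAut.conj_apply]

/-- The outer automorphism group `Out(K) = Aut(K) / Inn(K)`. -/
abbrev Out (K : Type u) [Group K] : Type u := MulAut K ⧸ Inn K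

/-- The class of an automorphism in `Out(K)`. -/
abbrev toOut (K : Type u) [Group K] : MulAut K →* Out K := QuotientGroup.mk' (Inn K)

/-- Restriction of automorphisms to the center. -/
def autCenter (K : Type u) [Group K] : MulAut K →* MulAut (Subgroup.center K) where
  toFun s := Subgroup.centerCongr s
  map_one' := rfl
  map_mul' _ _ := rfl

@[simp] theorem autCenter_apply_coe {K : Type u} [Group K] (s : MulAut K)
    (z : Subgroup.center K) : ((autCenter K s z : Subgroup.center K) : K) = s z := rfl

/-- The action of `Out(K)` on the center of `K` induced by restricting automorphisms. -/
def outCenter (K : Type u) [Group K] : Out K →* MulAut (Subgroup.center K) :=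
  QuotientGroup.lift (Inn K) (autCenter K) <| by
    rintro _ ⟨x, rfl⟩
    ext z
    have h := Subgroup.mem_center_iff.1 z.2 x
    simp [MulAut.conj_apply, h]

@[simp] theorem outCenter_toOut_coe {K : Type u} [Group K] (s : MulAut K)
    (z : Subgroup.center K) : ((outCenter K (toOut K s) z : Subgroup.center K) : K) = s z := rfl

variable {K H : Type u} [Group K] [Group H]

/-- The representation of `H` on the center of `K` (written additively) induced by `α`. -/
def centerRepresentation (α : H →* Out K) :
    Representation (ULift.{u} ℤ) H (Additive (Subgroup.center K)) where
  toFun h :=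
    { toFun := fun z => Additive.ofMul (outCenter K (α h) z.toMul)
      map_add' := fun a b => by simp
      map_smul' := fun n a => by
        change Additive.ofMul (outCenter K (α h) (a.toMul ^ n.down)) =
          Additive.ofMul ((outCenter K (α h) a.toMul) ^ n.down)
        rw [map_zpow] }
  map_one' := by
    ext z
    simp
  map_mul' g h := by
    ext z
    simp

/-- The center of `K` as an `H`-module through `α`. The coefficient ring is `ℤ`, lifted to the
universe of the groups as the group cohomology of Mathlib requires; a module over it is the same
thing as an abelian group. -/
abbrev centerRep (α : H →* Out K) : Rep.{u} (ULift.{u} ℤ) H := Rep.of (centerRepresentation α)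

/-- An element of the module `Z(K)`, written multiplicatively as an element of `K`. -/
def centerVal (α : H →* Out K) (z : centerRep α) : K :=
  (Additive.toMul (show Additive (Subgroup.center K) from z) : Subgroup.center K)

theorem centerVal_injective (α : H →* Out K) : Function.Injective (centerVal α) :=
  Subtype.val_injective

theorem centerVal_comm (α : H →* Out K) (z : centerRep α) (x : K) :
    x * centerVal α z = centerVal α z * x :=
  Subgroup.mem_center_iff.1
    (Additive.toMul (show Additive (Subgroup.center K) from z) : Subgroup.center K).2 x

@[simp] theorem centerVal_zero (α : H →* Out K) : centerVal α 0 = 1 := rfl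

@[simp] theorem centerVal_add (α : H →* Out K) (y z : centerRep α) :
    centerVal α (y + z) = centerVal α y * centerVal α z := rfl

@[simp] theorem centerVal_sub (α : H →* Out K) (y z : centerRep α) :
    centerVal α (y - z) = centerVal α y / centerVal α z := rfl

theorem centerVal_rho (α : H →* Out K) (h : H) (s : MulAut K) (hs : toOut K s = α h)
    (z : centerRep α) : centerVal α ((centerRep α).ρ h z) = s (centerVal α z) := by
  change ((outCenter K (α h) (Additive.toMul (show Additive (Subgroup.center K) from z)) :
    Subgroup.center K) : K) = _
  rw [← hs]
  rfl

/-! ## The obstruction class -/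

/-- A set-theoretic lift `t` of `α` to automorphisms, with elements `η g h` measuring the failure
of `t` to be multiplicative: `t g ∘ t h = c_{η g h} ∘ t (g h)`. -/
structure OuterLift (α : H →* Out K) where
  t : H → MulAut K
  η : H → H → K
  toOut_t : ∀ g, toOut K (t g) = α g
  t_mul : ∀ g h, t g * t h = MulAut.conj (η g h) * t (g * h)

/-- Every outer action has a lift. -/
theorem OuterLift.exists_lift (α : H →* Out K) : Nonempty (OuterLift α) := by
  choose t ht using fun g => QuotientGroup.mk'_surjective (Inn K) (α g)
  have h1 : ∀ g h, ∃ x : K, MulAut.conj x = t g * t h * (t (g * h))⁻¹ := by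
    intro g h
    have : t g * t h * (t (g * h))⁻¹ ∈ Inn K := by
      rw [← QuotientGroup.eq_one_iff]
      change toOut K _ = 1
      simp only [map_mul, map_inv]
      rw [ht, ht, ht, map_mul, mul_inv_cancel]
    exact this
  choose η hη using h1
  exact ⟨⟨t, η, ht, fun g h => by rw [hη]; group⟩⟩

namespace OuterLift

variable {α : H →* Out K} (L : OuterLift α)

theorem t_t_apply (g h : H) (x : K) :
    L.t g (L.t h x) = L.η g h * L.t (g * h) x * (L.η g h)⁻¹ := by
  simpa [MulAut.mul_apply, MulAut.conj_apply] using DFunLike.congr_fun (L.t_mul g h) x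

/-- The failure of the cocycle condition
`t g (η h k) * η g (h k) = η g h * η (g h) k`. -/
def defect (g h k : H) : K :=
  L.t g (L.η h k) * L.η g (h * k) * (L.η g h * L.η (g * h) k)⁻¹

theorem defect_spec (g h k : H) :
    L.t g (L.η h k) * L.η g (h * k) = L.defect g h k * (L.η g h * L.η (g * h) k) := by
  rw [defect, inv_mul_cancel_right]

theorem defect_mem_center (g h k : H) : L.defect g h k ∈ Subgroup.center K := by
  rw [Subgroup.mem_center_iff]
  have key : ∀ x : K, L.t g (L.η h k) * L.η g (h * k) * x * (L.t g (L.η h k) * L.η g (h * k))⁻¹ =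
      L.η g h * L.η (g * h) k * x * (L.η g h * L.η (g * h) k)⁻¹ := by
    intro x
    obtain ⟨y, rfl⟩ := (L.t (g * h * k)).surjective x
    have h1 : L.t g (L.t h (L.t k y)) = L.η g h * L.η (g * h) k * L.t (g * h * k) y *
        (L.η g h * L.η (g * h) k)⁻¹ := by
      rw [t_t_apply, t_t_apply]; group
    have h2 : L.t g (L.t h (L.t k y)) = L.t g (L.η h k) * L.η g (h * k) * L.t (g * h * k) y *
        (L.t g (L.η h k) * L.η g (h * k))⁻¹ := by
      rw [t_t_apply L h k, map_mul, map_mul, map_inv, t_t_apply, mul_assoc g h k]; group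
    rw [← h1, ← h2]
  intro x
  have := key ((L.η g h * L.η (g * h) k)⁻¹ * x * (L.η g h * L.η (g * h) k))
  rw [defect_spec] at this
  have h3 : L.defect g h k * x * (L.defect g h k)⁻¹ = x := by
    simpa [mul_assoc] using this
  rw [mul_inv_eq_iff_eq_mul] at h3
  exact h3.symm

theorem defect_comm (g h k : H) (x : K) : x * L.defect g h k = L.defect g h k * x :=
  Subgroup.mem_center_iff.1 (L.defect_mem_center g h k) x

theorem defect_cocycle (g h k l : H) :
    L.t g (L.defect h k l) * L.defect g (h * k) l * L.defect g h k =
      L.defect g h (k * l) * L.defect (g * h) k l := by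
  have e1 : L.t g (L.t h (L.η k l) * L.η h (k * l)) * L.η g (h * (k * l)) =
      (L.t g (L.defect h k l) * L.defect g (h * k) l * L.defect g h k) *
        (L.η g h * L.η (g * h) k * L.η (g * h * k) l) := by
    have a := L.defect_spec g (h * k) l
    have b := L.defect_spec g h k
    rw [defect_spec, map_mul, map_mul]
    calc _ = L.t g (L.defect h k l) * L.t g (L.η h k) *
          (L.t g (L.η (h * k) l) * L.η g (h * k * l)) := by simp only [mul_assoc]
      _ = L.t g (L.defect h k l) * (L.t g (L.η h k) * L.defect g (h * k) l) *
          (L.η g (h * k) * L.η (g * (h * k)) l) := by rw [a]; simp only [mul_assoc]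
      _ = L.t g (L.defect h k l) * L.defect g (h * k) l *
          (L.t g (L.η h k) * L.η g (h * k)) * L.η (g * (h * k)) l := by
            rw [L.defect_comm]; simp only [mul_assoc]
      _ = _ := by rw [b]; simp only [mul_assoc]
  have e2 : L.t g (L.t h (L.η k l) * L.η h (k * l)) * L.η g (h * (k * l)) =
      (L.defect g h (k * l) * L.defect (g * h) k l) *
        (L.η g h * L.η (g * h) k * L.η (g * h * k) l) := by
    have a := L.defect_spec g h (k * l)
    have b := L.defect_spec (g * h) k l
    rw [map_mul, t_t_apply]
    calc _ = L.η g h * L.t (g * h) (L.η k l) * (L.η g h)⁻¹ *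
          (L.t g (L.η h (k * l)) * L.η g (h * (k * l))) := by simp only [mul_assoc]
      _ = (L.η g h * L.t (g * h) (L.η k l) * (L.η g h)⁻¹ * L.defect g h (k * l)) *
          (L.η g h * L.η (g * h) (k * l)) := by rw [a]; simp only [mul_assoc]
      _ = L.defect g h (k * l) * L.η g h *
          (L.t (g * h) (L.η k l) * L.η (g * h) (k * l)) := by
            rw [L.defect_comm]; simp only [mul_assoc, inv_mul_cancel_left]
      _ = L.defect g h (k * l) * (L.η g h * L.defect (g * h) k l) *
          (L.η (g * h) k * L.η (g * h * k) l) := by rw [b]; simp only [mul_assoc]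
      _ = _ := by rw [L.defect_comm (g * h) k l (L.η g h)]; simp only [mul_assoc]
  exact mul_right_cancel (e1.symm.trans e2)

/-- The obstruction cochain: the defect as a function on triples with values in the center. -/
def obstructionCochain : (Fin 3 → H) → centerRep α := fun x =>
  Additive.ofMul (⟨L.defect (x 0) (x 1) (x 2), L.defect_mem_center _ _ _⟩ : Subgroup.center K)

theorem d_obstructionCochain :
    inhomogeneousCochains.d (centerRep α) 3 L.obstructionCochain = 0 := by
  funext x
  have key := L.defect_cocycle (x 0) (x 1) (x 2) (x 3)
  have hsum : (inhomogeneousCochains.d (centerRep α) 3 L.obstructionCochain : (Fin 4 → H) → _) x =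
      (centerRep α).ρ (x 0) (L.obstructionCochain ![x 1, x 2, x 3])
        - L.obstructionCochain ![x 0 * x 1, x 2, x 3]
        + L.obstructionCochain ![x 0, x 1 * x 2, x 3]
        - L.obstructionCochain ![x 0, x 1, x 2 * x 3]
        + L.obstructionCochain ![x 0, x 1, x 2] := by
    have hc : ∀ j : Fin 4, Fin.contractNth j (· * ·) x =
        (![![x 0 * x 1, x 2, x 3], ![x 0, x 1 * x 2, x 3], ![x 0, x 1, x 2 * x 3],
          ![x 0, x 1, x 2]] : Fin 4 → Fin 3 → H) j := by
      intro j
      funext i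
      fin_cases j <;> fin_cases i <;> rfl
    have hs : (fun i : Fin 3 => x i.succ) = ![x 1, x 2, x 3] := by
      funext i
      fin_cases i <;> rfl
    rw [inhomogeneousCochains.d_hom_apply, Fin.sum_univ_four, hs, hc, hc, hc, hc]
    simp [pow_succ]
    abel
  rw [hsum]
  refine centerVal_injective α ?_
  have hv : ∀ a b c : H, centerVal α (L.obstructionCochain ![a, b, c]) = L.defect a b c :=
    fun _ _ _ => rfl
  rw [centerVal_add, centerVal_sub, centerVal_add, centerVal_sub,
    centerVal_rho α (x 0) (L.t (x 0)) (L.toOut_t _)]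
  simp only [hv]
  change _ = (1 : K)
  generalize hA : L.t (x 0) (L.defect (x 1) (x 2) (x 3)) = a at key ⊢
  have c1 := L.defect_comm (x 0 * x 1) (x 2) (x 3)
  have c2 := L.defect_comm (x 0) (x 1) (x 2 * x 3)
  generalize L.defect (x 0 * x 1) (x 2) (x 3) = b at key c1 ⊢
  generalize L.defect (x 0) (x 1) (x 2 * x 3) = c at key c2 ⊢
  generalize L.defect (x 0) (x 1 * x 2) (x 3) = d at key ⊢
  generalize L.defect (x 0) (x 1) (x 2) = e at key ⊢
  have b1 : ∀ y, y * b⁻¹ = b⁻¹ * y := fun y => by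
    rw [mul_inv_eq_iff_eq_mul, mul_assoc, c1, inv_mul_cancel_left]
  have b2 : ∀ y, y * c⁻¹ = c⁻¹ * y := fun y => by
    rw [mul_inv_eq_iff_eq_mul, mul_assoc, c2, inv_mul_cancel_left]
  calc a / b * d / c * e = (a * b⁻¹) * d * c⁻¹ * e := by simp only [div_eq_mul_inv]
    _ = b⁻¹ * (a * d * c⁻¹) * e := by rw [b1 a]; simp only [mul_assoc]
    _ = b⁻¹ * c⁻¹ * (a * d * e) := by rw [b2 (a * d)]; simp only [mul_assoc]
    _ = 1 := by rw [key]; group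

/-- The class of the obstruction cochain in `H³(H, Z(K))`. -/
noncomputable def obstructionClass : groupCohomology (centerRep α) 3 :=
  groupCohomology.π (centerRep α) 3
    (groupCohomology.cocyclesMk L.obstructionCochain L.d_obstructionCochain)

end OuterLift

/-- The obstruction class of an outer action, computed from some lift. -/
noncomputable def obstructionClass (α : H →* Out K) : groupCohomology (centerRep α) 3 :=
  (Classical.choice (OuterLift.exists_lift α)).obstructionClass

/-! ## Extensions inducing a given outer action -/

/-- An extension `1 → K → E → H → 1` whose conjugation action of `E` on `K` induces `α`. -/
structure OuterExtension (α : H →* Out K) where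
  E : Type u
  [group : Group E]
  ext : GroupExtension K E H
  induces : ∀ e : E, toOut K (ext.conjAct e) = α (ext.rightHom e)

attribute [instance] OuterExtension.group

/-- Extensions are equivalent if there is an isomorphism of the middle groups that restricts to
the identity of `K` and induces the identity of `H`. -/
instance OuterExtension.setoid (α : H →* Out K) : Setoid (OuterExtension α) where
  r S S' := Nonempty (S.ext.Equiv S'.ext)
  iseqv :=
    { refl := fun S => ⟨GroupExtension.Equiv.refl S.ext⟩
      symm := fun ⟨e⟩ => ⟨e.symm⟩
      trans := fun ⟨e⟩ ⟨e'⟩ => ⟨e.trans e'⟩ }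

/-- The set `ℰ(K, H, α)` of equivalence classes of extensions of `H` by `K` inducing `α`. -/
def ExtensionClasses (α : H →* Out K) : Type (u + 1) := Quotient (OuterExtension.setoid α)

/-- The equivalence class of an extension. -/
def OuterExtension.toClass {α : H →* Out K} (S : OuterExtension α) : ExtensionClasses α :=
  Quotient.mk _ S

/-! ## Twisting an extension by a 2-cocycle -/

namespace OuterExtension

variable {α : H →* Out K} (S : OuterExtension α) (c : groupCohomology.cocycles₂ (centerRep α))

/-- The value of a 2-cocycle as an element of `K`. -/
def val (c : groupCohomology.cocycles₂ (centerRep α)) (g h : H) : K := centerVal α (c (g, h))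

theorem val_comm (g h : H) (x : K) : x * val c g h = val c g h * x := centerVal_comm α _ x

theorem val_cocycle (e : S.E) (h k : H) :
    val c (S.ext.rightHom e * h) k * val c (S.ext.rightHom e) h =
      S.ext.conjAct e (val c h k) * val c (S.ext.rightHom e) (h * k) := by
  have h1 := congrArg (centerVal α)
    ((groupCohomology.mem_cocycles₂_iff _).1 c.2 (S.ext.rightHom e) h k)
  rw [centerVal_add, centerVal_add,
    centerVal_rho α (S.ext.rightHom e) (S.ext.conjAct e) (S.induces e)] at h1
  exact h1

theorem mul_inl (e : S.E) (x : K) : e * S.ext.inl x = S.ext.inl (S.ext.conjAct e x) * e := by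
  rw [GroupExtension.inl_conjAct_comm, inv_mul_cancel_right]

theorem conjAct_comm_val (e : S.E) (g h : H) (x : K) :
    x * S.ext.conjAct e (val c g h) = S.ext.conjAct e (val c g h) * x := by
  obtain ⟨y, rfl⟩ := (S.ext.conjAct e).surjective x
  rw [← map_mul, val_comm, map_mul]

theorem val_one_left (h : H) : val c 1 h = val c 1 1 := by
  have := groupCohomology.cocycles₂_map_one_fst c h
  exact congrArg (centerVal α) this

theorem val_one_right (e : S.E) :
    val c (S.ext.rightHom e) 1 = S.ext.conjAct e (val c 1 1) := by
  have := S.val_cocycle c e 1 1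
  simp only [mul_one] at this
  exact mul_right_cancel this

/-- The set underlying `E`, to be given the multiplication twisted by the cocycle `c`. -/
@[ext]
structure Twist (_c : groupCohomology.cocycles₂ (centerRep α)) where
  val : S.E

namespace Twist

/-- The twisted multiplication `e * e' = c(ē, ē') e e'`, where `ē` is the image of `e` in `H`. -/
instance : Mul (Twist S c) where
  mul e e' := ⟨S.ext.inl (OuterExtension.val c (S.ext.rightHom e.val) (S.ext.rightHom e'.val)) *
    (e.val * e'.val)⟩

instance : One (Twist S c) where
  one := ⟨S.ext.inl (OuterExtension.val c 1 1)⁻¹⟩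

instance : Inv (Twist S c) where
  inv e := ⟨S.ext.inl ((OuterExtension.val c 1 1)⁻¹ *
    (OuterExtension.val c (S.ext.rightHom e.val)⁻¹ (S.ext.rightHom e.val))⁻¹) * e.val⁻¹⟩

theorem mul_val (e e' : Twist S c) : (e * e').val =
    S.ext.inl (OuterExtension.val c (S.ext.rightHom e.val) (S.ext.rightHom e'.val)) *
      (e.val * e'.val) := rfl

theorem one_val : (1 : Twist S c).val = S.ext.inl (OuterExtension.val c 1 1)⁻¹ := rfl

theorem inv_val (e : Twist S c) : (e⁻¹).val = S.ext.inl ((OuterExtension.val c 1 1)⁻¹ *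
    (OuterExtension.val c (S.ext.rightHom e.val)⁻¹ (S.ext.rightHom e.val))⁻¹) * e.val⁻¹ := rfl

instance : Group (Twist S c) :=
  Group.ofLeftAxioms
    (by
      rintro ⟨a⟩ ⟨b⟩ ⟨d⟩
      ext
      have key := congrArg S.ext.inl
        (S.val_cocycle c a (S.ext.rightHom b) (S.ext.rightHom d))
      rw [← OuterExtension.conjAct_comm_val] at key
      simp only [mul_val, map_mul, GroupExtension.rightHom_inl, one_mul] at key ⊢
      calc _ = (S.ext.inl (OuterExtension.val c (S.ext.rightHom a * S.ext.rightHom b)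
              (S.ext.rightHom d)) *
            S.ext.inl (OuterExtension.val c (S.ext.rightHom a) (S.ext.rightHom b))) *
            (a * b * d) := by simp only [mul_assoc]
        _ = S.ext.inl (OuterExtension.val c (S.ext.rightHom a)
              (S.ext.rightHom b * S.ext.rightHom d)) *
            (S.ext.inl (S.ext.conjAct a (OuterExtension.val c (S.ext.rightHom b)
              (S.ext.rightHom d))) * a) * (b * d) := by rw [key]; simp only [mul_assoc]
        _ = _ := by rw [← S.mul_inl]; simp only [mul_assoc])
    (by
      rintro ⟨a⟩
      ext
      simp only [mul_val, one_val, GroupExtension.rightHom_inl]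
      rw [OuterExtension.val_one_left, map_inv, mul_inv_cancel_left])
    (by
      rintro ⟨a⟩
      ext
      simp only [mul_val, one_val, inv_val, map_mul, GroupExtension.rightHom_inl, map_inv,
        inv_one, one_mul]
      rw [inv_mul_cancel_right, ← map_inv S.ext.rightHom, ← map_inv S.ext.inl,
        ← map_inv S.ext.inl, ← map_mul S.ext.inl, ← map_mul S.ext.inl, ← mul_assoc, ← OuterExtension.val_comm, mul_inv_cancel_right])

end Twist

/-- The twisted group as an extension, with the same projection to `H`, and with the inclusion of
`K` shifted by the new unit (so that it is unchanged if `c` is normalized). -/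
def twistExt : GroupExtension K (Twist S c) H where
  inl :=
    { toFun := fun x => ⟨S.ext.inl (x * (val c 1 1)⁻¹)⟩
      map_one' := by
        ext
        simp [Twist.one_val]
      map_mul' := fun x y => by
        ext
        simp only [Twist.mul_val, GroupExtension.rightHom_inl, ← map_mul]
        congr 1
        have h := val_comm c 1 1 x
        calc x * y * (val c 1 1)⁻¹ = x * val c 1 1 * (val c 1 1)⁻¹ * y * (val c 1 1)⁻¹ := by
              group
          _ = val c 1 1 * (x * (val c 1 1)⁻¹ * (y * (val c 1 1)⁻¹)) := by
              rw [h]; simp only [mul_assoc] }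
  rightHom :=
    { toFun := fun e => S.ext.rightHom e.val
      map_one' := by simp [Twist.one_val]
      map_mul' := fun a b => by simp [Twist.mul_val] }
  inl_injective := fun x y h => by
    have h' := S.ext.inl_injective (congrArg Twist.val h)
    exact mul_right_cancel h'
  range_inl_eq_ker_rightHom := by
    ext ⟨e⟩
    constructor
    · rintro ⟨x, hx⟩
      have hx' := congrArg Twist.val hx
      change S.ext.rightHom e = 1
      rw [← show _ = e from hx']
      exact S.ext.rightHom_inl _
    · intro he
      have he' : e ∈ S.ext.inl.range := by
        rw [S.ext.range_inl_eq_ker_rightHom]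
        exact he
      obtain ⟨x, rfl⟩ := he'
      refine ⟨x * val c 1 1, ?_⟩
      ext
      change S.ext.inl (x * val c 1 1 * (val c 1 1)⁻¹) = _
      rw [mul_inv_cancel_right]
  rightHom_surjective := fun h => by
    obtain ⟨e, he⟩ := S.ext.rightHom_surjective h
    exact ⟨⟨e⟩, he⟩

theorem twistExt_inl_val (x : K) :
    ((S.twistExt c).inl x).val = S.ext.inl (x * (val c 1 1)⁻¹) := rfl

theorem twistExt_rightHom (e : Twist S c) :
    (S.twistExt c).rightHom e = S.ext.rightHom e.val := rfl

/-- Twisting does not change the conjugation action on `K`. -/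
theorem twistExt_conjAct (e : Twist S c) : (S.twistExt c).conjAct e = S.ext.conjAct e.val := by
  ext x
  apply (S.twistExt c).inl_injective
  rw [GroupExtension.inl_conjAct_comm, mul_inv_eq_iff_eq_mul]
  ext
  simp only [twistExt_inl_val, Twist.mul_val, GroupExtension.rightHom_inl]
  rw [val_one_left c (S.ext.rightHom e.val), val_one_right, S.mul_inl, ← mul_assoc, ← mul_assoc,
    ← map_mul S.ext.inl, ← map_mul S.ext.inl]
  congr 2
  rw [map_mul, map_inv, ← mul_assoc, ← conjAct_comm_val, mul_inv_cancel_right, ← mul_assoc,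
    ← val_comm, mul_inv_cancel_right]

/-- The twist of an extension by a 2-cocycle with values in the center of `K`. If `η` is the factor
set of a section of the given extension, so that `σ g σ h = η(g, h) σ(g h)`, then the same section
has the factor set `c η` in the twisted extension. -/
def twist : OuterExtension α where
  E := Twist S c
  ext := S.twistExt c
  induces e := by rw [twistExt_conjAct, twistExt_rightHom, S.induces]

end OuterExtension

end ClassicalExtension

namespace ClassicalExtension

open CategoryTheory
open scoped IsMulCommutative

/-! ## Cochains in degrees two and three -/

/-! The argument is Schreier's theory of factor sets. A set-theoretic section `σ` of an extension
gives a lift of `α`: conjugation by `σ g` gives `t g`, and `σ g * σ h = i (η g h) * σ (g * h)`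
defines `η`. Associativity in the middle group forces the defect of this lift to be `1`
(`Realizes.defect_eq_one`). Conversely, a lift without defect turns `K × H` into an extension
(`toOuterExtension`).

Any two lifts are related by two moves. Composing each `t g` with an inner automorphism can be
compensated in `η` without changing the defect (`defect_conjBy`). With `t` fixed, `η` can change
only by a central function `b`, which adds the coboundary of `b` to the obstruction cochain
(`obstructionCochain_mulCentral`). Hence the class is independent of the lift, and it vanishes
exactly when some lift has no defect.

For the action, an extension is determined up to equivalence by any factor set it realizes
(`Realizes.nonempty_equiv`), and twisting by `c` replaces `η` by `c η` (`Realizes.twist`). The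
action laws and transitivity thus become statements about factor sets. Freeness holds because two
sections with the same `t` differ by a central function, which changes `η` by a coboundary. -/

/-- The differential of inhomogeneous `2`-cochains. -/
theorem inhomogeneousCochains_d_two_apply {k G : Type u} [CommRing k] [Group G] (A : Rep.{u} k G)
    (b : (Fin 2 → G) → A) (x : Fin 3 → G) :
    (inhomogeneousCochains.d A 2 b : (Fin 3 → G) → A) x =
      A.ρ (x 0) (b ![x 1, x 2]) - b ![x 0 * x 1, x 2] + b ![x 0, x 1 * x 2] - b ![x 0, x 1] := by
  have hc : ∀ j : Fin 3, Fin.contractNth j (· * ·) x =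
      (![![x 0 * x 1, x 2], ![x 0, x 1 * x 2], ![x 0, x 1]] : Fin 3 → Fin 2 → G) j := by
    intro j
    funext i
    fin_cases j <;> fin_cases i <;> rfl
  have hs : (fun i : Fin 2 => x i.succ) = ![x 1, x 2] := by
    funext i
    fin_cases i <;> rfl
  rw [inhomogeneousCochains.d_hom_apply, Fin.sum_univ_three, hs, hc, hc, hc]
  simp [pow_succ]
  abel

theorem inhomogeneousCochains_d_sub {k G : Type u} [CommRing k] [Group G] (A : Rep.{u} k G)
    (n : ℕ) (a b : (Fin n → G) → A) :
    inhomogeneousCochains.d A n (a - b) =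
      (inhomogeneousCochains.d A n a : (Fin (n + 1) → G) → A) - inhomogeneousCochains.d A n b :=
  LinearMap.map_sub (inhomogeneousCochains.d A n).hom a b

theorem cocyclesMk_sub {k G : Type u} [CommRing k] [Group G] (A : Rep.{u} k G)
    (n : ℕ) (a b : (Fin n → G) → A) (ha : inhomogeneousCochains.d A n a = 0)
    (hb : inhomogeneousCochains.d A n b = 0) (hab : inhomogeneousCochains.d A n (a - b) = 0) :
    groupCohomology.cocyclesMk (a - b) hab =
      groupCohomology.cocyclesMk a ha - groupCohomology.cocyclesMk b hb := by
  -- Cocycles embed in cochains, so the identity can be checked on underlying functions.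
  apply (ModuleCat.mono_iff_injective (groupCohomology.iCocycles A n)).1 inferInstance
  rw [map_sub]
  exact (groupCohomology.iCocycles_mk _ _).trans (congrArg₂ (· - ·)
    (groupCohomology.iCocycles_mk _ _) (groupCohomology.iCocycles_mk _ _)).symm

/-- A cocycle represents zero in group cohomology if and only if it is a coboundary. -/
theorem π_cocyclesMk_eq_zero_iff {k G : Type u} [CommRing k] [Group G] (A : Rep.{u} k G) (n : ℕ)
    (f : (Fin (n + 1) → G) → A) (hf : inhomogeneousCochains.d A (n + 1) f = 0) :
    groupCohomology.π A (n + 1) (groupCohomology.cocyclesMk f hf) = 0 ↔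
      ∃ b : (Fin n → G) → A, inhomogeneousCochains.d A n b = f := by
  -- Cohomology is the cokernel of the map from `n`-cochains to `(n + 1)`-cocycles, so the kernel of
  -- the projection is the range of that map.
  have hex := (ShortComplex.moduleCat_exact_iff _).1 (ShortComplex.exact_of_g_is_cokernel
    (ShortComplex.mk _ _
      ((groupCohomology.inhomogeneousCochains A).toCycles_comp_homologyπ n (n + 1)))
    ((groupCohomology.inhomogeneousCochains A).homologyIsCokernel n (n + 1) (by simp)))
  have hinj : Function.Injective (groupCohomology.iCocycles A (n + 1)) :=
    (ModuleCat.mono_iff_injective _).1 inferInstance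
  have hto : ∀ b : (Fin n → G) → A,
      groupCohomology.iCocycles A (n + 1) (groupCohomology.toCocycles A n (n + 1) b) =
        inhomogeneousCochains.d A n b := by
    intro b
    rw [← groupCohomology.inhomogeneousCochains.d_def, ← HomologicalComplex.toCycles_i]
    rfl
  constructor
  · intro h
    obtain ⟨b, hb⟩ := hex _ h
    refine ⟨b, ?_⟩
    rw [← hto, ← groupCohomology.iCocycles_mk f hf]
    exact congrArg _ hb
  · rintro ⟨b, hb⟩
    have : groupCohomology.toCocycles A n (n + 1) b = groupCohomology.cocyclesMk f hf :=
      hinj (by rw [hto, groupCohomology.iCocycles_mk, hb])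
    rw [← this]
    exact ConcreteCategory.congr_hom
      ((groupCohomology.inhomogeneousCochains A).toCycles_comp_homologyπ n (n + 1)) b

variable {K H : Type u} [Group K] [Group H] {α : H →* Out K}

/-- A central element of `K` as an element of the module `Z(K)`. -/
def ofCenter (α : H →* Out K) (x : K) (hx : x ∈ Subgroup.center K) : centerRep α :=
  Additive.ofMul (⟨x, hx⟩ : Subgroup.center K)

@[simp] theorem centerVal_ofCenter (x : K) (hx : x ∈ Subgroup.center K) :
    centerVal α (ofCenter α x hx) = x := rfl

/-- Elements defining the same inner automorphism differ by a central element. -/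
theorem mem_center_of_conj_mul_eq {x y : K} {s : MulAut K}
    (h : MulAut.conj x * s = MulAut.conj y * s) : x * y⁻¹ ∈ Subgroup.center K := by
  rw [Subgroup.mem_center_iff]
  intro z
  -- Conjugation by `y` sends this element to `z`, hence so does conjugation by `x`.
  have h1 := DFunLike.congr_fun (mul_right_cancel h) (y⁻¹ * z * y)
  simp only [MulAut.conj_apply] at h1
  calc z * (x * y⁻¹) = (y * (y⁻¹ * z * y) * y⁻¹) * (x * y⁻¹) := by group
    _ = x * y⁻¹ * z := by rw [← h1]; group

namespace OuterLift

attribute [ext] OuterLift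

/-! ## Changing the lift of an outer action -/

/-- The lift obtained by composing the chosen automorphisms with inner automorphisms. -/
def conjBy (L : OuterLift α) (x : H → K) : OuterLift α where
  t g := MulAut.conj (x g) * L.t g
  -- This is the factor set that results from replacing a section `σ g` by `i (x g) * σ g`.
  η g h := x g * L.t g (x h) * L.η g h * (x (g * h))⁻¹
  toOut_t g := by
    have : toOut K (MulAut.conj (x g)) = 1 := (QuotientGroup.eq_one_iff _).2 ⟨x g, rfl⟩
    rw [map_mul, this, one_mul, L.toOut_t]
  t_mul g h := by
    ext y
    change x g * L.t g (x h * L.t h y * (x h)⁻¹) * (x g)⁻¹ =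
      (x g * L.t g (x h) * L.η g h * (x (g * h))⁻¹) *
        (x (g * h) * L.t (g * h) y * (x (g * h))⁻¹) *
        (x g * L.t g (x h) * L.η g h * (x (g * h))⁻¹)⁻¹
    rw [map_mul, map_mul, map_inv, t_t_apply]
    group

/-- After expansion the only nonformal term is `t g (t h (x k))`. Rewriting it through `t (g * h)`
makes the factors coming from `x` agree on both sides, and the old defect, being central, can be
moved to the front. -/
theorem defect_conjBy (L : OuterLift α) (x : H → K) (g h k : H) :
    (L.conjBy x).defect g h k = L.defect g h k := by
  rw [defect, mul_inv_eq_iff_eq_mul]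
  simp only [conjBy, MulAut.mul_apply, MulAut.conj_apply, map_mul, map_inv, mul_assoc g h k]
  calc _ = x g * L.t g (x h) * L.t g (L.t h (x k)) * (L.t g (L.η h k) * L.η g (h * k)) *
        (x (g * (h * k)))⁻¹ := by group
    _ = (x g * L.t g (x h) * L.η g h * L.t (g * h) (x k) * (L.η g h)⁻¹) * L.defect g h k *
        (L.η g h * L.η (g * h) k) * (x (g * (h * k)))⁻¹ := by
      rw [t_t_apply, defect_spec]; simp only [mul_assoc]
    _ = _ := by rw [L.defect_comm]; group

/-- The lift obtained by multiplying the factor set by a central function. -/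
def mulCentral (L : OuterLift α) (b : H → H → centerRep α) : OuterLift α where
  t := L.t
  η g h := centerVal α (b g h) * L.η g h
  toOut_t := L.toOut_t
  t_mul g h := by
    ext y
    have hc := centerVal_comm α (b g h) (L.η g h * L.t (g * h) y * (L.η g h)⁻¹)
    simp only [MulAut.mul_apply, MulAut.conj_apply, t_t_apply]
    calc _ = L.η g h * L.t (g * h) y * (L.η g h)⁻¹ * centerVal α (b g h) *
          (centerVal α (b g h))⁻¹ := by group
      _ = _ := by rw [hc]; group

theorem obstructionCochain_mulCentral (L : OuterLift α) (b : H → H → centerRep α) :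
    (L.mulCentral b).obstructionCochain =
      (inhomogeneousCochains.d (centerRep α) 2 (fun x => b (x 0) (x 1)) :
        (Fin 3 → H) → centerRep α) + L.obstructionCochain := by
  funext x
  refine centerVal_injective α ?_
  rw [Pi.add_apply, centerVal_add]
  have hd := inhomogeneousCochains_d_two_apply (centerRep α) (fun x => b (x 0) (x 1)) x
  generalize (inhomogeneousCochains.d (centerRep α) 2 (fun x => b (x 0) (x 1)) :
        (Fin 3 → H) → centerRep α) x = z at hd ⊢
  -- The coboundary formula is written without subtraction, so that in `K` it becomes an identity of
  -- products free of inverses.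
  have hz : z + (b (x 0 * x 1) (x 2) + b (x 0) (x 1)) =
      (centerRep α).ρ (x 0) (b (x 1) (x 2)) + b (x 0) (x 1 * x 2) := by
    rw [hd]
    simp only [Matrix.cons_val_zero, Matrix.cons_val_one]
    abel
  have hz' := congrArg (centerVal α) hz
  rw [centerVal_add, centerVal_add, centerVal_add,
    centerVal_rho α (x 0) (L.t (x 0)) (L.toOut_t _)] at hz'
  change (L.mulCentral b).defect (x 0) (x 1) (x 2) = _ * L.defect (x 0) (x 1) (x 2)
  rw [defect, mul_inv_eq_iff_eq_mul]
  simp only [mulCentral, map_mul]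
  generalize x 0 = g at *
  generalize x 1 = h at *
  generalize x 2 = k at *
  calc _ = L.t g (centerVal α (b h k)) * (L.t g (L.η h k) * centerVal α (b g (h * k))) *
        L.η g (h * k) := by simp only [mul_assoc]
    _ = (L.t g (centerVal α (b h k)) * centerVal α (b g (h * k))) *
        (L.t g (L.η h k) * L.η g (h * k)) := by rw [centerVal_comm]; simp only [mul_assoc]
    _ = centerVal α z * centerVal α (b (g * h) k) * (centerVal α (b g h) * L.defect g h k) *
        (L.η g h * L.η (g * h) k) := by rw [← hz', defect_spec]; simp only [mul_assoc]
    _ = centerVal α z * (centerVal α (b (g * h) k) * (L.defect g h k *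
        (centerVal α (b g h) * L.η g h))) * L.η (g * h) k := by
      rw [← centerVal_comm α (b g h)]; simp only [mul_assoc]
    _ = _ := by rw [← centerVal_comm α (b (g * h) k)]; simp only [mul_assoc]

/-- With `t` fixed, `t_mul` prescribes the inner automorphism of each `η g k`, hence `η g k` up to
the center. -/
theorem exists_eq_mulCentral (L L' : OuterLift α) (h : L'.t = L.t) :
    ∃ b, L' = L.mulCentral b := by
  have hc : ∀ g k, L'.η g k * (L.η g k)⁻¹ ∈ Subgroup.center K := fun g k =>
    mem_center_of_conj_mul_eq (s := L.t (g * k)) (by rw [← L.t_mul, ← h, L'.t_mul])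
  refine ⟨fun g k => ofCenter α _ (hc g k), ?_⟩
  ext g k
  · rw [h]; rfl
  · simp [mulCentral]

theorem exists_eq_conjBy_t (L L' : OuterLift α) : ∃ x, L'.t = (L.conjBy x).t := by
  have h : ∀ g, ∃ x : K, MulAut.conj x = L'.t g * (L.t g)⁻¹ := by
    intro g
    have : L'.t g * (L.t g)⁻¹ ∈ Inn K := by
      rw [← QuotientGroup.eq_one_iff]
      change toOut K _ = 1
      rw [map_mul, map_inv, L.toOut_t, L'.toOut_t, mul_inv_cancel]
    exact this
  choose x hx using h
  refine ⟨x, funext fun g => ?_⟩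
  simp [conjBy, hx]

theorem obstructionClass_eq_of_d_add (L L' : OuterLift α) (b : (Fin 2 → H) → centerRep α)
    (h : L'.obstructionCochain = (inhomogeneousCochains.d (centerRep α) 2 b :
      (Fin 3 → H) → centerRep α) + L.obstructionCochain) :
    L'.obstructionClass = L.obstructionClass := by
  rw [obstructionClass, obstructionClass, ← sub_eq_zero, ← map_sub]
  have hd : inhomogeneousCochains.d (centerRep α) 3
      (L'.obstructionCochain - L.obstructionCochain) = 0 := by
    rw [inhomogeneousCochains_d_sub, d_obstructionCochain, d_obstructionCochain]
    exact sub_zero _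
  rw [← cocyclesMk_sub _ _ _ _ _ _ hd, π_cocyclesMk_eq_zero_iff]
  exact ⟨b, by rw [h, add_sub_cancel_right]⟩

/-- Inner corrections first match the automorphisms without affecting the cochain; the remaining
central change of factor set contributes only a coboundary. -/
theorem obstructionClass_eq (L L' : OuterLift α) : L'.obstructionClass = L.obstructionClass := by
  obtain ⟨x, hx⟩ := L.exists_eq_conjBy_t L'
  obtain ⟨b, rfl⟩ := (L.conjBy x).exists_eq_mulCentral L' hx
  refine obstructionClass_eq_of_d_add _ _ _
    ((obstructionCochain_mulCentral _ b).trans (congrArg _ ?_))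
  funext y
  exact centerVal_injective α (L.defect_conjBy x _ _ _)

theorem exists_defect_eq_one (L : OuterLift α) (h : L.obstructionClass = 0) :
    ∃ L' : OuterLift α, ∀ g h k, L'.defect g h k = 1 := by
  obtain ⟨b, hb⟩ := (π_cocyclesMk_eq_zero_iff _ _ _ _).1 h
  -- Here `b` has the obstruction cochain as its coboundary, so multiplying `η` by the inverse of
  -- `b` cancels the defect.
  refine ⟨L.mulCentral fun g k => (0 - b) ![g, k], fun g h k => ?_⟩
  have h1 := L.obstructionCochain_mulCentral fun g k => (0 - b) ![g, k]
  have h2 : (fun x : Fin 2 → H => (0 - b) ![x 0, x 1]) = 0 - b := by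
    funext x
    refine congrArg (0 - b) (funext fun i => ?_)
    fin_cases i <;> rfl
  rw [h2, inhomogeneousCochains_d_sub, hb, sub_add_cancel] at h1
  have h3 := h1.trans (LinearMap.map_zero (inhomogeneousCochains.d (centerRep α) 2).hom)
  exact congrArg (centerVal α) (congrFun h3 ![g, h, k])

theorem obstructionClass_eq_zero (L : OuterLift α) (h : ∀ g h k, L.defect g h k = 1) :
    L.obstructionClass = 0 := by
  have h0 : L.obstructionCochain = 0 := funext fun x => centerVal_injective α (h _ _ _)
  refine (π_cocyclesMk_eq_zero_iff _ _ _ _).2 ⟨0, ?_⟩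
  exact (LinearMap.map_zero (inhomogeneousCochains.d (centerRep α) 2).hom).trans h0.symm

/-- Two lifts with the same automorphisms and vanishing defects differ by a `2`-cocycle. -/
theorem mem_cocycles₂_of_defect_eq_one (L : OuterLift α) (b : H → H → centerRep α)
    (h : ∀ g h k, L.defect g h k = 1) (h' : ∀ g h k, (L.mulCentral b).defect g h k = 1) :
    (fun x : H × H => b x.1 x.2) ∈ groupCohomology.cocycles₂ (centerRep α) := by
  rw [groupCohomology.mem_cocycles₂_def]
  intro g k l
  have h0 : L.obstructionCochain = 0 := funext fun x => centerVal_injective α (h _ _ _)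
  have h0' : (L.mulCentral b).obstructionCochain = 0 :=
    funext fun x => centerVal_injective α (h' _ _ _)
  have h1 := L.obstructionCochain_mulCentral b
  -- Both obstruction cochains vanish, so the change-of-factor-set formula says that the coboundary
  -- of `b` is zero.
  rw [h0, h0', add_zero] at h1
  exact ((congrFun h1 ![g, k, l]).trans (inhomogeneousCochains_d_two_apply _ _ _)).symm

end OuterLift

/-! ## Factor sets of extensions -/

namespace OuterExtension

/-- The section `σ` of the extension `S` has conjugation action `L.t` and factor set `L.η`. -/
structure Realizes (S : OuterExtension α) (L : OuterLift α) (σ : H → S.E) : Prop where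
  rightHom_section : ∀ g, S.ext.rightHom (σ g) = g
  conjAct_section : ∀ g, S.ext.conjAct (σ g) = L.t g
  section_mul : ∀ g h, σ g * σ h = S.ext.inl (L.η g h) * σ (g * h)

theorem exists_inl_of_rightHom_eq (S : OuterExtension α) {e e' : S.E}
    (h : S.ext.rightHom e = S.ext.rightHom e') : ∃ x : K, e = S.ext.inl x * e' := by
  have : e * e'⁻¹ ∈ S.ext.inl.range := by
    rw [S.ext.range_inl_eq_ker_rightHom, MonoidHom.mem_ker, map_mul, map_inv, h, mul_inv_cancel]
  obtain ⟨x, hx⟩ := this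
  exact ⟨x, by rw [hx, inv_mul_cancel_right]⟩

theorem conjAct_inl (S : OuterExtension α) (x : K) :
    S.ext.conjAct (S.ext.inl x) = MulAut.conj x := by
  ext y
  apply S.ext.inl_injective
  rw [GroupExtension.inl_conjAct_comm, MulAut.conj_apply, map_mul, map_mul, map_inv]

/-- Any lift of `α` to automorphisms is the conjugation action of a section. -/
theorem exists_realizes (S : OuterExtension α) (t : H → MulAut K)
    (ht : ∀ g, toOut K (t g) = α g) :
    ∃ (L : OuterLift α) (σ : H → S.E), L.t = t ∧ S.Realizes L σ := by
  have h : ∀ g, ∃ e : S.E, S.ext.rightHom e = g ∧ S.ext.conjAct e = t g := by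
    intro g
    obtain ⟨e, rfl⟩ := S.ext.rightHom_surjective g
    have : t (S.ext.rightHom e) * (S.ext.conjAct e)⁻¹ ∈ Inn K := by
      rw [← QuotientGroup.eq_one_iff]
      change toOut K _ = 1
      rw [map_mul, map_inv, ht, S.induces, mul_inv_cancel]
    obtain ⟨x, hx⟩ := this
    -- Any preimage of `g` acts by `t g` up to an inner automorphism, and multiplying by an element
    -- of `K` corrects this.
    refine ⟨S.ext.inl x * e, by simp, ?_⟩
    rw [map_mul, conjAct_inl, show MulAut.conj x = _ from hx, inv_mul_cancel_right]
  choose σ hσ hc using h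
  have h2 : ∀ g k, ∃ x : K, σ g * σ k = S.ext.inl x * σ (g * k) := fun g k =>
    S.exists_inl_of_rightHom_eq (by rw [map_mul, hσ, hσ, hσ])
  choose η hη using h2
  refine ⟨⟨t, η, ht, fun g k => ?_⟩, σ, rfl, hσ, hc, hη⟩
  rw [← hc, ← hc, ← hc, ← map_mul, hη, map_mul, conjAct_inl]

namespace Realizes

variable {S S' : OuterExtension α} {L : OuterLift α} {σ : H → S.E} {σ' : H → S'.E}

theorem section_mul_inl (hσ : S.Realizes L σ) (g : H) (x : K) :
    σ g * S.ext.inl x = S.ext.inl (L.t g x) * σ g := by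
  rw [S.mul_inl, hσ.conjAct_section]

theorem section_one (hσ : S.Realizes L σ) : σ 1 = S.ext.inl (L.η 1 1) := by
  have := hσ.section_mul 1 1
  rw [mul_one] at this
  exact mul_right_cancel this

theorem exists_eq (hσ : S.Realizes L σ) (e : S.E) :
    ∃ x : K, e = S.ext.inl x * σ (S.ext.rightHom e) :=
  S.exists_inl_of_rightHom_eq (hσ.rightHom_section _).symm

/-- The factor set of an extension has no defect. -/
theorem defect_eq_one (hσ : S.Realizes L σ) (g h k : H) : L.defect g h k = 1 := by
  rw [OuterLift.defect, mul_inv_eq_one]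
  apply S.ext.inl_injective
  -- After this multiplication both sides are bracketings of `σ g * σ h * σ k`.
  apply mul_right_cancel (b := σ (g * h * k))
  calc _ = S.ext.inl (L.t g (L.η h k)) * (S.ext.inl (L.η g (h * k)) * σ (g * (h * k))) := by
        rw [map_mul, mul_assoc, mul_assoc]
    _ = σ g * (σ h * σ k) := by
        rw [← hσ.section_mul, ← mul_assoc, ← hσ.section_mul_inl, hσ.section_mul h k, mul_assoc]
    _ = S.ext.inl (L.η g h) * (S.ext.inl (L.η (g * h) k) * σ (g * h * k)) := by
        rw [← hσ.section_mul, ← mul_assoc, ← mul_assoc, ← hσ.section_mul]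
    _ = _ := by rw [map_mul, mul_assoc (S.ext.inl _)]

theorem map (hσ : S.Realizes L σ) (e : S.ext.Equiv S'.ext) :
    S'.Realizes L (fun g => e (σ g)) where
  rightHom_section g := by rw [e.rightHom_map, hσ.rightHom_section]
  conjAct_section g := by
    ext x
    apply S'.ext.inl_injective
    rw [GroupExtension.inl_conjAct_comm, ← e.map_inl, ← e.map_inl, ← hσ.conjAct_section,
      GroupExtension.inl_conjAct_comm, map_mul, map_mul, map_inv]
  section_mul g h := by rw [← map_mul, hσ.section_mul, map_mul, e.map_inl]

/-- Extensions with a common factor set are equivalent. -/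
theorem nonempty_equiv (hσ : S.Realizes L σ) (hσ' : S'.Realizes L σ') :
    Nonempty (S.ext.Equiv S'.ext) := by
  choose x hx using hσ.exists_eq
  -- Normal forms `i y * σ g` are unique. The isomorphism carries `i y * σ g` to `i' y * σ' g`; it
  -- is multiplicative because the product of normal forms depends only on `t` and `η`.
  have hx' : ∀ e y g, e = S.ext.inl y * σ g → g = S.ext.rightHom e ∧ y = x e := by
    intro e y g h
    have hg : g = S.ext.rightHom e := by simp [h, hσ.rightHom_section]
    subst hg
    exact ⟨rfl, S.ext.inl_injective (mul_right_cancel (h.symm.trans (hx e)))⟩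
  let f : S.E →* S'.E := MonoidHom.mk' (fun e => S'.ext.inl (x e) * σ' (S.ext.rightHom e)) <| by
    intro a b
    have h : a * b = S.ext.inl (x a * L.t (S.ext.rightHom a) (x b) *
        L.η (S.ext.rightHom a) (S.ext.rightHom b)) *
          σ (S.ext.rightHom a * S.ext.rightHom b) := by
      conv_lhs => rw [hx a, hx b]
      rw [map_mul, map_mul, mul_assoc _ _ (σ _), ← hσ.section_mul]
      simp only [mul_assoc]
      rw [← mul_assoc (σ _) (S.ext.inl _), hσ.section_mul_inl, mul_assoc]
    rw [map_mul, ← (hx' _ _ _ h).2, map_mul, map_mul, mul_assoc _ _ (σ' _), ← hσ'.section_mul]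
    simp only [mul_assoc]
    rw [← mul_assoc (σ' _) (S'.ext.inl _), hσ'.section_mul_inl, mul_assoc]
  refine ⟨GroupExtension.Equiv.ofMonoidHom f ?_ ?_⟩
  · ext y
    -- The section need not be normalized: `σ 1` is `i (η 1 1)`.
    have h : S.ext.inl y = S.ext.inl (y * (L.η 1 1)⁻¹) * σ 1 := by
      rw [hσ.section_one, ← map_mul, inv_mul_cancel_right]
    change S'.ext.inl (x (S.ext.inl y)) * σ' (S.ext.rightHom (S.ext.inl y)) = _
    rw [← (hx' _ _ _ h).2, ← (hx' _ _ _ h).1, hσ'.section_one, ← map_mul, inv_mul_cancel_right]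
  · ext e
    change S'.ext.rightHom (S'.ext.inl (x e) * σ' (S.ext.rightHom e)) = _
    rw [map_mul, GroupExtension.rightHom_inl, one_mul, hσ'.rightHom_section]

/-- Twisting by a cocycle multiplies the factor set by the cocycle. -/
theorem twist (hσ : S.Realizes L σ) (c : groupCohomology.cocycles₂ (centerRep α)) :
    (S.twist c).Realizes (L.mulCentral fun g h => c (g, h)) (fun g => Twist.mk (σ g)) where
  rightHom_section g := hσ.rightHom_section g
  conjAct_section g := (S.twistExt_conjAct c _).trans (hσ.conjAct_section g)
  section_mul g h := by
    refine Twist.ext ?_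
    change S.ext.inl (val c (S.ext.rightHom (σ g)) (S.ext.rightHom (σ h))) * (σ g * σ h) =
      S.ext.inl (val c (S.ext.rightHom (S.ext.inl _)) (S.ext.rightHom (σ (g * h)))) *
        (S.ext.inl (val c g h * L.η g h * (val c 1 1)⁻¹) * σ (g * h))
    -- The twisted product on the right contributes `c(1, g h) = c(1, 1)`, which cancels the shift
    -- in the twisted inclusion.
    rw [GroupExtension.rightHom_inl, val_one_left, hσ.rightHom_section, hσ.rightHom_section,
      hσ.section_mul, ← mul_assoc, ← mul_assoc, ← map_mul, ← map_mul, ← mul_assoc (val c 1 1),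
      ← val_comm c 1 1, mul_inv_cancel_right]

/-- Multiplying a section by a central function multiplies its factor set by the coboundary. -/
theorem mul_section (hσ : S.Realizes L σ) (b : H → centerRep α) :
    S.Realizes (L.mulCentral fun g h => groupCohomology.d₁₂ (centerRep α) b (g, h))
      (fun g => S.ext.inl (centerVal α (b g)) * σ g) where
  rightHom_section g := by simp [hσ.rightHom_section]
  conjAct_section g := by
    ext x
    rw [map_mul, conjAct_inl, hσ.conjAct_section, MulAut.mul_apply, MulAut.conj_apply,
      ← centerVal_comm, mul_inv_cancel_right]
    rfl
  section_mul g h := by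
    have hd : groupCohomology.d₁₂ (centerRep α) b (g, h) + b (g * h) =
        (centerRep α).ρ g (b h) + b g := by
      rw [groupCohomology.d₁₂_hom_apply]
      abel
    have hd' := congrArg (centerVal α) hd
    rw [centerVal_add, centerVal_add, centerVal_rho α g (L.t g) (L.toOut_t g)] at hd'
    calc _ = S.ext.inl (centerVal α (b g)) * (σ g * S.ext.inl (centerVal α (b h))) * σ h := by
          simp only [mul_assoc]
      _ = S.ext.inl (centerVal α (b g) * L.t g (centerVal α (b h)) * L.η g h) * σ (g * h) := by
          rw [hσ.section_mul_inl, map_mul, map_mul, mul_assoc _ _ (σ (g * h)), ← hσ.section_mul]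
          simp only [mul_assoc]
      _ = S.ext.inl (centerVal α (groupCohomology.d₁₂ (centerRep α) b (g, h)) *
            (centerVal α (b (g * h)) * L.η g h)) * σ (g * h) := by
          rw [← centerVal_comm, ← hd', mul_assoc]
      _ = _ := by
          rw [← centerVal_comm α (b (g * h)) (L.η g h), ← mul_assoc (centerVal _ _), map_mul, mul_assoc]
          rfl

/-- Two sections of an extension with the same conjugation action differ by a central function. -/
theorem exists_eq_mul_section {L' : OuterLift α} {τ : H → S.E} (hσ : S.Realizes L σ)
    (hτ : S.Realizes L' τ) (h : L'.t = L.t) :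
    ∃ b : H → centerRep α, ∀ g, τ g = S.ext.inl (centerVal α (b g)) * σ g := by
  have hx : ∀ g, ∃ x : K, τ g = S.ext.inl x * σ g := fun g =>
    S.exists_inl_of_rightHom_eq (by rw [hσ.rightHom_section, hτ.rightHom_section])
  choose x hx using hx
  have hc : ∀ g, x g ∈ Subgroup.center K := by
    intro g
    have := mem_center_of_conj_mul_eq (x := x g) (y := 1) (s := L.t g) (by
      rw [← hσ.conjAct_section, ← conjAct_inl S, ← map_mul, ← hx, hτ.conjAct_section, h,
        hσ.conjAct_section, map_one, one_mul])
    rwa [inv_one, mul_one] at this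
  exact ⟨fun g => ofCenter α (x g) (hc g), hx⟩

theorem eta_eq {L' : OuterLift α} (hσ : S.Realizes L σ) (hσ' : S.Realizes L' σ) (g h : H) :
    L.η g h = L'.η g h :=
  S.ext.inl_injective (mul_right_cancel ((hσ.section_mul g h).symm.trans (hσ'.section_mul g h)))

end Realizes

end OuterExtension

/-! ## The extension defined by a lift without defect -/

namespace OuterLift

variable (L : OuterLift α)

theorem t_one_apply (x : K) : L.t 1 x = L.η 1 1 * x * (L.η 1 1)⁻¹ := by
  have h := L.t_mul 1 1
  rw [mul_one] at h
  rw [mul_right_cancel h, MulAut.conj_apply]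

theorem cocycle_of_defect_eq_one (hL : ∀ g h k, L.defect g h k = 1) (g h k : H) :
    L.t g (L.η h k) * L.η g (h * k) = L.η g h * L.η (g * h) k := by
  rw [defect_spec, hL, one_mul]

/-- The cocycle identity at `(1, 1, h)` gives `t 1 (η 1 h) = η 1 1`, and `t 1` is conjugation by `η
1 1`. -/
theorem eta_one_left (hL : ∀ g h k, L.defect g h k = 1) (h : H) : L.η 1 h = L.η 1 1 := by
  have := L.cocycle_of_defect_eq_one hL 1 1 h
  rw [one_mul, one_mul] at this
  have h1 := mul_right_cancel this
  rw [t_one_apply, mul_inv_eq_iff_eq_mul] at h1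
  exact mul_left_cancel h1

theorem eta_one_right (hL : ∀ g h k, L.defect g h k = 1) (g : H) :
    L.t g (L.η 1 1) = L.η g 1 := by
  have := L.cocycle_of_defect_eq_one hL g 1 1
  rw [mul_one, mul_one] at this
  exact mul_right_cancel this

/-- The set `K × H`, to be given the multiplication defined by a factor set. -/
@[ext]
structure CrossedProduct (L : OuterLift α) (_hL : ∀ g h k, L.defect g h k = 1) where
  left : K
  right : H

namespace CrossedProduct

variable (hL : ∀ g h k, L.defect g h k = 1)

/-- The pair `(x, g)` stands for `i x * σ g`. The unit has left entry `(η 1 1)⁻¹` because `σ 1`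
stands for `η 1 1`. -/
instance : Mul (CrossedProduct L hL) where
  mul a b := ⟨a.left * L.t a.right b.left * L.η a.right b.right, a.right * b.right⟩

instance : One (CrossedProduct L hL) where
  one := ⟨(L.η 1 1)⁻¹, 1⟩

instance : Inv (CrossedProduct L hL) where
  inv a := ⟨(L.t a.right⁻¹ a.left * L.η a.right⁻¹ a.right * L.η 1 1)⁻¹, a.right⁻¹⟩

variable {L hL}

theorem mul_left_eq (a b : CrossedProduct L hL) :
    (a * b).left = a.left * L.t a.right b.left * L.η a.right b.right := rfl

theorem mul_right_eq (a b : CrossedProduct L hL) : (a * b).right = a.right * b.right := rfl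

theorem one_left_eq : (1 : CrossedProduct L hL).left = (L.η 1 1)⁻¹ := rfl

theorem one_right_eq : (1 : CrossedProduct L hL).right = 1 := rfl

theorem inv_left_eq (a : CrossedProduct L hL) :
    (a⁻¹).left = (L.t a.right⁻¹ a.left * L.η a.right⁻¹ a.right * L.η 1 1)⁻¹ := rfl

theorem inv_right_eq (a : CrossedProduct L hL) : (a⁻¹).right = a.right⁻¹ := rfl

variable (L hL)

instance : Group (CrossedProduct L hL) :=
  Group.ofLeftAxioms
    (by
      intro a b d
      ext
      · simp only [mul_left_eq, mul_right_eq, map_mul]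
        calc _ = a.left * L.t a.right b.left *
              (L.η a.right b.right * L.t (a.right * b.right) d.left * (L.η a.right b.right)⁻¹) *
              (L.η a.right b.right * L.η (a.right * b.right) d.right) := by group
          _ = _ := by
            rw [← t_t_apply, ← L.cocycle_of_defect_eq_one hL]
            simp only [mul_assoc]
      · exact mul_assoc _ _ _)
    (by
      intro a
      ext
      · rw [mul_left_eq, one_left_eq, one_right_eq, t_one_apply, L.eta_one_left hL a.right]
        group
      · exact one_mul _)
    (by
      intro a
      ext
      · rw [mul_left_eq, inv_left_eq, inv_right_eq, one_left_eq]
        group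
      · exact inv_mul_cancel _)

end CrossedProduct

/-- The crossed product of a factor set as a group extension. -/
def crossedExt (hL : ∀ g h k, L.defect g h k = 1) : GroupExtension K (CrossedProduct L hL) H where
  inl := MonoidHom.mk' (fun x => ⟨x * (L.η 1 1)⁻¹, 1⟩) <| by
    intro x y
    ext
    · rw [CrossedProduct.mul_left_eq]
      simp only [t_one_apply]
      group
    · exact (one_mul _).symm
  rightHom := MonoidHom.mk' CrossedProduct.right fun _ _ => rfl
  inl_injective x y h := mul_right_cancel (congrArg CrossedProduct.left h)
  range_inl_eq_ker_rightHom := by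
    ext ⟨x, g⟩
    constructor
    · rintro ⟨y, hy⟩
      exact (congrArg CrossedProduct.right hy).symm
    · intro hg
      obtain rfl : g = 1 := hg
      exact ⟨x * L.η 1 1, CrossedProduct.ext (mul_inv_cancel_right _ _) rfl⟩
  rightHom_surjective h := ⟨⟨1, h⟩, rfl⟩

theorem crossedExt_conjAct (hL : ∀ g h k, L.defect g h k = 1) (a : CrossedProduct L hL) :
    (L.crossedExt hL).conjAct a = MulAut.conj a.left * L.t a.right := by
  ext y
  apply (L.crossedExt hL).inl_injective
  rw [GroupExtension.inl_conjAct_comm, mul_inv_eq_iff_eq_mul]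
  ext
  · change a.left * L.t a.right (y * (L.η 1 1)⁻¹) * L.η a.right 1 =
      a.left * L.t a.right y * a.left⁻¹ * (L.η 1 1)⁻¹ * L.t 1 a.left * L.η 1 a.right
    -- The values of `η` at `(g, 1)` and `(1, g)` absorb the shifts by `(η 1 1)⁻¹` in the inclusion.
    rw [map_mul, map_inv, L.eta_one_right hL, L.eta_one_left hL a.right, t_one_apply]
    group
  · exact (mul_one _).trans (one_mul _).symm

/-- A lift without defect defines an extension inducing the outer action. -/
def toOuterExtension (hL : ∀ g h k, L.defect g h k = 1) : OuterExtension α where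
  E := CrossedProduct L hL
  ext := L.crossedExt hL
  induces a := by
    have : toOut K (MulAut.conj a.left) = 1 := (QuotientGroup.eq_one_iff _).2 ⟨a.left, rfl⟩
    rw [crossedExt_conjAct, map_mul, this, one_mul, L.toOut_t]
    rfl

end OuterLift

/-- An outer action is realized by an extension if and only if its obstruction vanishes. -/
theorem nonempty_extensionClasses_iff :
    Nonempty (ExtensionClasses α) ↔ obstructionClass α = 0 := by
  constructor
  · rintro ⟨x⟩
    induction x using Quotient.inductionOn with | _ S => ?_
    obtain ⟨M⟩ := OuterLift.exists_lift α
    obtain ⟨L, σ, -, hσ⟩ := S.exists_realizes M.t M.toOut_t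
    -- By independence of the lift, the class may be computed from a section of the given extension.
    rw [obstructionClass, OuterLift.obstructionClass_eq L]
    exact L.obstructionClass_eq_zero hσ.defect_eq_one
  · intro h
    obtain ⟨L, hL⟩ := OuterLift.exists_defect_eq_one _ h
    exact ⟨(L.toOuterExtension hL).toClass⟩

/-! ## The action of `H²(H, Z(K))` on the classes of extensions -/

namespace OuterExtension

theorem exists_lift_realizes (S : OuterExtension α) :
    ∃ (L : OuterLift α) (σ : H → S.E), S.Realizes L σ := by
  obtain ⟨M⟩ := OuterLift.exists_lift α
  obtain ⟨L, σ, -, hσ⟩ := S.exists_realizes M.t M.toOut_t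
  exact ⟨L, σ, hσ⟩

theorem toClass_eq_iff {S S' : OuterExtension α} :
    S.toClass = S'.toClass ↔ Nonempty (S.ext.Equiv S'.ext) := Quotient.eq

/-- An equivalence transports a section together with its factor set, so both twists realize the
same product `c η`. -/
theorem toClass_twist_congr {S S' : OuterExtension α} (h : S.toClass = S'.toClass)
    (c : groupCohomology.cocycles₂ (centerRep α)) :
    (S.twist c).toClass = (S'.twist c).toClass := by
  obtain ⟨e⟩ := toClass_eq_iff.1 h
  obtain ⟨L, σ, hσ⟩ := S.exists_lift_realizes
  exact toClass_eq_iff.2 ((hσ.twist c).nonempty_equiv ((hσ.map e).twist c))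

theorem toClass_twist_zero (S : OuterExtension α) : (S.twist 0).toClass = S.toClass := by
  obtain ⟨L, σ, hσ⟩ := S.exists_lift_realizes
  have h : L.mulCentral (fun g h => (0 : groupCohomology.cocycles₂ (centerRep α)) (g, h)) = L := by
    ext g h
    · rfl
    · exact one_mul _
  exact toClass_eq_iff.2 ((h ▸ hσ.twist 0 :).nonempty_equiv hσ)

theorem toClass_twist_add (S : OuterExtension α) (c d : groupCohomology.cocycles₂ (centerRep α)) :
    (S.twist (c + d)).toClass = ((S.twist d).twist c).toClass := by
  obtain ⟨L, σ, hσ⟩ := S.exists_lift_realizes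
  have h : L.mulCentral (fun g h => (c + d) (g, h)) =
      (L.mulCentral fun g h => d (g, h)).mulCentral fun g h => c (g, h) := by
    ext g h
    · rfl
    · exact mul_assoc _ _ _
  exact toClass_eq_iff.2 ((h ▸ hσ.twist (c + d) :).nonempty_equiv ((hσ.twist d).twist c))

/-- Twisting by a cocycle preserves the class of an extension if and only if the cocycle is a
coboundary. -/
theorem toClass_twist_eq_iff (S : OuterExtension α) (c : groupCohomology.cocycles₂ (centerRep α)) :
    (S.twist c).toClass = S.toClass ↔ groupCohomology.H2π (centerRep α) c = 0 := by
  rw [groupCohomology.H2π_eq_zero_iff]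
  obtain ⟨L, σ, hσ⟩ := S.exists_lift_realizes
  constructor
  · intro h
    obtain ⟨e⟩ := toClass_eq_iff.1 h
    have hτ := (hσ.twist c).map e
    -- The twisted section, transported back to `S`, still acts by `t`. Its factor set is both `c η`
    -- and the coboundary of `b` times `η`, so `c` is that coboundary.
    obtain ⟨b, hb⟩ := hσ.exists_eq_mul_section hτ rfl
    rw [funext hb] at hτ
    refine ⟨b, funext fun x => centerVal_injective α ?_⟩
    exact mul_right_cancel ((hσ.mul_section b).eta_eq hτ x.1 x.2)
  · rintro ⟨b, hb⟩
    have h := hσ.mul_section b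
    rw [show (fun g h => groupCohomology.d₁₂ (centerRep α) b (g, h)) = fun g h => c (g, h) from
      funext₂ fun g h => congrFun hb (g, h)] at h
    exact toClass_eq_iff.2 ((hσ.twist c).nonempty_equiv h)

theorem toClass_twist_eq_of_H2π_eq (S : OuterExtension α)
    {c d : groupCohomology.cocycles₂ (centerRep α)}
    (h : groupCohomology.H2π (centerRep α) c = groupCohomology.H2π (centerRep α) d) :
    (S.twist c).toClass = (S.twist d).toClass := by
  have h1 : groupCohomology.H2π (centerRep α) (c - d) = 0 := by
    rw [map_sub, h, sub_self]
  -- Twisting by `c` is twisting by `d` followed by the coboundary `c - d`.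
  rw [← sub_add_cancel c d, toClass_twist_add, toClass_twist_eq_iff, h1]

theorem exists_toClass_twist_eq (S S' : OuterExtension α) :
    ∃ c, (S.twist c).toClass = S'.toClass := by
  obtain ⟨L, σ, hσ⟩ := S.exists_lift_realizes
  -- Choosing a section of `S'` with the automorphisms of `L` leaves a central difference between
  -- the factor sets; it is a cocycle since neither has a defect.
  obtain ⟨L', σ', ht, hσ'⟩ := S'.exists_realizes L.t L.toOut_t
  obtain ⟨b, rfl⟩ := L.exists_eq_mulCentral L' ht
  exact ⟨⟨_, L.mem_cocycles₂_of_defect_eq_one b hσ.defect_eq_one hσ'.defect_eq_one⟩,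
    toClass_eq_iff.2 ((hσ.twist _).nonempty_equiv hσ')⟩

end OuterExtension

theorem H2π_surjective (α : H →* Out K) :
    Function.Surjective (groupCohomology.H2π (centerRep α)) :=
  (ModuleCat.epi_iff_surjective _).1 inferInstance

/-- The twist of a class of extensions by a cocycle. -/
def ExtensionClasses.twist (c : groupCohomology.cocycles₂ (centerRep α))
    (x : ExtensionClasses α) : ExtensionClasses α :=
  Quotient.lift (fun S : OuterExtension α => (S.twist c).toClass)
    (fun _ _ h => OuterExtension.toClass_twist_congr (Quotient.sound h) c) x

theorem ExtensionClasses.twist_eq_of_H2π_eq {c d : groupCohomology.cocycles₂ (centerRep α)}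
    (h : groupCohomology.H2π (centerRep α) c = groupCohomology.H2π (centerRep α) d)
    (x : ExtensionClasses α) : x.twist c = x.twist d := by
  induction x using Quotient.inductionOn with | _ S => ?_
  exact S.toClass_twist_eq_of_H2π_eq h

/-- The action of `H²(H, Z(K))` on classes of extensions by twisting with cocycles. -/
@[reducible]
noncomputable def extensionClassesAddAction (α : H →* Out K) :
    AddAction (groupCohomology (centerRep α) 2) (ExtensionClasses α) where
  -- The chosen representative is immaterial by `twist_eq_of_H2π_eq`.
  vadd a x := x.twist (Function.surjInv (H2π_surjective α) a)
  zero_vadd x := by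
    induction x using Quotient.inductionOn with | _ S => ?_
    refine (ExtensionClasses.twist_eq_of_H2π_eq (d := 0) ?_ _).trans S.toClass_twist_zero
    rw [Function.surjInv_eq (H2π_surjective α), map_zero]
  add_vadd a b x := by
    induction x using Quotient.inductionOn with | _ S => ?_
    refine (ExtensionClasses.twist_eq_of_H2π_eq (d := Function.surjInv (H2π_surjective α) a +
      Function.surjInv (H2π_surjective α) b) ?_ _).trans (S.toClass_twist_add _ _)
    rw [map_add, Function.surjInv_eq (H2π_surjective α), Function.surjInv_eq (H2π_surjective α),
      Function.surjInv_eq (H2π_surjective α)]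

end ClassicalExtension

theorem mainTheorem3 {K H : Type u} [Group K] [Group H]
    (α : H →* ClassicalExtension.Out K) :
    (∀ L : ClassicalExtension.OuterLift α,
      L.obstructionClass = ClassicalExtension.obstructionClass α) ∧
    (Nonempty (ClassicalExtension.ExtensionClasses α) ↔
      ClassicalExtension.obstructionClass α = 0) ∧
    (Nonempty (ClassicalExtension.ExtensionClasses α) →
      ∃ _ : AddAction (groupCohomology (ClassicalExtension.centerRep α) 2)
          (ClassicalExtension.ExtensionClasses α),
        (∀ (c : groupCohomology.cocycles₂ (ClassicalExtension.centerRep α))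
            (S : ClassicalExtension.OuterExtension α),
          groupCohomology.H2π (ClassicalExtension.centerRep α) c +ᵥ S.toClass =
            (S.twist c).toClass) ∧
        (∀ (a : groupCohomology (ClassicalExtension.centerRep α) 2)
            (x : ClassicalExtension.ExtensionClasses α), a +ᵥ x = x → a = 0) ∧
        (∀ x y : ClassicalExtension.ExtensionClasses α,
          ∃ a : groupCohomology (ClassicalExtension.centerRep α) 2, a +ᵥ x = y)) := by
  refine ⟨fun L => ClassicalExtension.OuterLift.obstructionClass_eq _ L,
    ClassicalExtension.nonempty_extensionClasses_iff, fun _ => ?_⟩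
  let := ClassicalExtension.extensionClassesAddAction α
  have hv : ∀ (c : groupCohomology.cocycles₂ (ClassicalExtension.centerRep α))
      (S : ClassicalExtension.OuterExtension α),
      groupCohomology.H2π (ClassicalExtension.centerRep α) c +ᵥ S.toClass =
        (S.twist c).toClass := fun c S =>
    S.toClass_twist_eq_of_H2π_eq (Function.surjInv_eq (ClassicalExtension.H2π_surjective α) _)
  refine ⟨this, hv, fun a x h => ?_, fun x y => ?_⟩
  · induction x using Quotient.inductionOn with | _ S => ?_
    obtain ⟨c, rfl⟩ := ClassicalExtension.H2π_surjective α a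
    exact (S.toClass_twist_eq_iff c).1 ((hv c S).symm.trans h)
  · induction x using Quotient.inductionOn with | _ S => ?_
    induction y using Quotient.inductionOn with | _ S' => ?_
    obtain ⟨c, hc⟩ := S.exists_toClass_twist_eq S'
    exact ⟨_, (hv c S).trans hc⟩
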